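/- Let $n\ge 1$, let $\Omega\subset\mathbb R^n$ be open and bounded (no regularity of $\partial\Omega$ is assumed), let $1<p<\infty$ and $\frac1p+\frac1{p'}=1$, and let $g\in L^{p'}(\Omega)$ and $f_b\in W^{1,p}(\Omega)$. Let $T:W^{1,1}(\Omega)\to W^{1,\infty}(\Omega,\mathbb R^n)^*$ be the linear continuous trace operator given by $$\langle Tf,\varphi\rangle=\int_\Omega f\,\operatorname{div}\varphi\,dx+\int_\Omega \varphi\cdot Df\,dx\qquad\text{for } f\in W^{1,1}(\Omega),\ \varphi\in W^{1,\infty}(\Omega,\mathbb R^n),$$ which is also a linear continuous operator on $W^{1,p}(\Omega)$ by the continuous embedding $W^{1,p}(\Omega)\hookrightarrow W^{1,1}(\Omega)$. Then the boundary value problem $$-\operatorname{div}\big(|Df|^{p-2}Df\big)=g\ \text{ on }\Omega,\qquad f=f_b\ \text{ on }\partial\Omega$$ has a weak solution, i.e. there is $f\in W^{1,p}(\Omega)$ such that $$\int_\Omega \big(|Df|^{p-2}Df\cdot D\psi-g\,\psi\big)\,dx=0\qquad\text{for all }\psi\in C_c^\infty(\Omega)$$ and $$\langle T(f-f_b),\varphi\rangle=0\qquad\text{for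 all }\varphi\in W^{1,\infty}(\Omega,\mathbb R^n).$$ (Here $|Df|^{p-2}Df$ is understood to be $0$ where $Df=0$.) -/

import Mathlib

open MeasureTheory TopologicalSpace
open scoped ENNReal Distributions

noncomputable section

/-- `Grad n F` holds the partial derivatives `(D₁ u, …, Dₙ u)` of an `F`-valued function on `ℝⁿ`,
with the Euclidean norm `(∑ i, |Dᵢ u|²) ^ (1/2)`.  For `F = ℝ` this is `EuclideanSpace ℝ (Fin n)`;
for `F = ℝᵐ` it is the space of `mn`-vectors with the Euclidean norm. -/
abbrev Grad (n : ℕ) (F : Type*) := PiLp 2 (fun _ : Fin n => F)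

/-- `G` is the weak gradient of `u` on the open set `Ω`:
`∫_Ω (∂ᵢ ψ) u dx = - ∫_Ω ψ Gᵢ dx` for all `ψ ∈ C_c^∞(Ω)` and all `i`. -/
def IsWeakGradient {n : ℕ} {F : Type*} [NormedAddCommGroup F] [NormedSpace ℝ F]
    (Ω : Opens (EuclideanSpace ℝ (Fin n)))
    (u : EuclideanSpace ℝ (Fin n) → F) (G : EuclideanSpace ℝ (Fin n) → Grad n F) : Prop :=
  ∀ (ψ : 𝓓(Ω, ℝ)) (i : Fin n),
    ∫ x in (Ω : Set (EuclideanSpace ℝ (Fin n))), fderiv ℝ ψ x (EuclideanSpace.single i 1) • u x =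
      - ∫ x in (Ω : Set (EuclideanSpace ℝ (Fin n))), ψ x • G x i

theorem IsWeakGradient.congr_ae {n : ℕ} {F : Type*} [NormedAddCommGroup F] [NormedSpace ℝ F]
    {Ω : Opens (EuclideanSpace ℝ (Fin n))}
    {u v : EuclideanSpace ℝ (Fin n) → F} {G H : EuclideanSpace ℝ (Fin n) → Grad n F}
    (h : IsWeakGradient Ω u G)
    (huv : v =ᵐ[volume.restrict (Ω : Set (EuclideanSpace ℝ (Fin n)))] u)
    (hGH : H =ᵐ[volume.restrict (Ω : Set (EuclideanSpace ℝ (Fin n)))] G) :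
    IsWeakGradient Ω v H := by
  intro ψ i
  refine Eq.trans ?_ ((h ψ i).trans ?_)
  · refine integral_congr_ae ?_
    filter_upwards [huv] with x hx
    rw [hx]
  · refine congrArg _ (integral_congr_ae ?_)
    filter_upwards [hGH] with x hx
    rw [hx]

/-- A continuous compactly supported scalar function times an `L^p` function is integrable. -/
theorem integrable_smul_of_memLp {n : ℕ} {F : Type*} [NormedAddCommGroup F] [NormedSpace ℝ F]
    {p : ℝ≥0∞} (hp : 1 ≤ p) {μ : Measure (EuclideanSpace ℝ (Fin n))} [IsLocallyFiniteMeasure μ]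
    {a : EuclideanSpace ℝ (Fin n) → ℝ} (ha : Continuous a) (hc : HasCompactSupport a)
    {u : EuclideanSpace ℝ (Fin n) → F} (hu : MemLp u p μ) :
    Integrable (fun x => a x • u x) μ :=
  (hu.locallyIntegrable hp).integrable_smul_left_of_hasCompactSupport ha hc

/-- The Sobolev space `W^{1,p}(Ω, F)`, as the space of pairs `(u, Du)` of classes in `L^p(Ω)` in
which the second entry is the weak gradient of the first.  The norm inherited from `WithLp p` is
`(‖u‖_p ^ p + ‖Du‖_p ^ p) ^ (1/p)` for `p < ∞` and `max ‖u‖_∞ ‖Du‖_∞` for `p = ∞`. -/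
def SobolevSpace {n : ℕ} (Ω : Opens (EuclideanSpace ℝ (Fin n)))
    (F : Type*) [NormedAddCommGroup F] [NormedSpace ℝ F] (p : ℝ≥0∞) [hp : Fact (1 ≤ p)] :
    Submodule ℝ (WithLp p
      (Lp F p (volume.restrict (Ω : Set (EuclideanSpace ℝ (Fin n)))) ×
        Lp (Grad n F) p (volume.restrict (Ω : Set (EuclideanSpace ℝ (Fin n)))))) where
  carrier := {w | IsWeakGradient Ω w.fst w.snd}
  zero_mem' := by
    intro ψ i
    have h1 : ∫ x in (Ω : Set (EuclideanSpace ℝ (Fin n))), fderiv ℝ ψ x (EuclideanSpace.single i 1)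
        • (0 : Lp F p (volume.restrict (Ω : Set (EuclideanSpace ℝ (Fin n))))) x = 0 := by
      refine integral_eq_zero_of_ae ?_
      filter_upwards [Lp.coeFn_zero F p (volume.restrict (Ω : Set (EuclideanSpace ℝ (Fin n))))]
        with x hx
      exact (congrArg _ hx).trans (smul_zero _)
    have h2 : ∫ x in (Ω : Set (EuclideanSpace ℝ (Fin n))), ψ x
        • (0 : Lp (Grad n F) p (volume.restrict (Ω : Set (EuclideanSpace ℝ (Fin n))))) x i = 0 := by
      refine integral_eq_zero_of_ae ?_
      filter_upwards [Lp.coeFn_zero (Grad n F) p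
        (volume.restrict (Ω : Set (EuclideanSpace ℝ (Fin n))))] with x hx
      exact (congrArg (fun y : Grad n F => ψ x • y i) hx).trans (smul_zero _)
    exact h1.trans (by rw [← neg_zero, ← h2]; rfl)
  add_mem' := by
    intro v w hv hw ψ i
    have hd : Continuous fun x => fderiv ℝ ψ x (EuclideanSpace.single i 1) :=
      (ψ.contDiff.continuous_fderiv (by simp)).clm_apply continuous_const
    have hdc : HasCompactSupport fun x => fderiv ℝ ψ x (EuclideanSpace.single i 1) :=
      ψ.hasCompactSupport.fderiv_apply ℝ _
    have e1 : ∫ x in (Ω : Set (EuclideanSpace ℝ (Fin n))),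
        fderiv ℝ ψ x (EuclideanSpace.single i 1) • (v + w).fst x =
        (∫ x in (Ω : Set (EuclideanSpace ℝ (Fin n))),
          fderiv ℝ ψ x (EuclideanSpace.single i 1) • v.fst x) +
        ∫ x in (Ω : Set (EuclideanSpace ℝ (Fin n))),
          fderiv ℝ ψ x (EuclideanSpace.single i 1) • w.fst x := by
      rw [← integral_add (integrable_smul_of_memLp hp.out hd hdc (Lp.memLp v.fst))
        (integrable_smul_of_memLp hp.out hd hdc (Lp.memLp w.fst))]
      refine integral_congr_ae ?_
      filter_upwards [Lp.coeFn_add v.fst w.fst] with x hx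
      rw [← smul_add]
      exact congrArg _ hx
    have hi : ∀ z : Lp (Grad n F) p (volume.restrict (Ω : Set (EuclideanSpace ℝ (Fin n)))),
        Integrable (fun x => ψ x • z x i)
          (volume.restrict (Ω : Set (EuclideanSpace ℝ (Fin n)))) := fun z =>
      (PiLp.proj (𝕜 := ℝ) 2 (fun _ : Fin n => F) i).integrable_comp
        (integrable_smul_of_memLp hp.out ψ.continuous ψ.hasCompactSupport (Lp.memLp z))
    have e2 : ∫ x in (Ω : Set (EuclideanSpace ℝ (Fin n))), ψ x • (v + w).snd x i =
        (∫ x in (Ω : Set (EuclideanSpace ℝ (Fin n))), ψ x • v.snd x i) +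
        ∫ x in (Ω : Set (EuclideanSpace ℝ (Fin n))), ψ x • w.snd x i := by
      rw [← integral_add (hi _) (hi _)]
      refine integral_congr_ae ?_
      filter_upwards [Lp.coeFn_add v.snd w.snd] with x hx
      rw [← smul_add]
      exact congrArg (fun y : Grad n F => ψ x • y i) hx
    rw [e1, e2, hv ψ i, hw ψ i, neg_add]
  smul_mem' := by
    intro c v hv ψ i
    have e1 : ∫ x in (Ω : Set (EuclideanSpace ℝ (Fin n))),
        fderiv ℝ ψ x (EuclideanSpace.single i 1) • (c • v).fst x =
        c • ∫ x in (Ω : Set (EuclideanSpace ℝ (Fin n))),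
          fderiv ℝ ψ x (EuclideanSpace.single i 1) • v.fst x := by
      rw [← integral_smul]
      refine integral_congr_ae ?_
      filter_upwards [Lp.coeFn_smul c v.fst] with x hx
      rw [smul_comm c]
      exact congrArg _ hx
    have e2 : ∫ x in (Ω : Set (EuclideanSpace ℝ (Fin n))), ψ x • (c • v).snd x i =
        c • ∫ x in (Ω : Set (EuclideanSpace ℝ (Fin n))), ψ x • v.snd x i := by
      rw [← integral_smul]
      refine integral_congr_ae ?_
      filter_upwards [Lp.coeFn_smul c v.snd] with x hx
      rw [smul_comm c]
      exact congrArg (fun y : Grad n F => ψ x • y i) hx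
    rw [e1, e2, hv ψ i, smul_neg]

namespace SobolevSpace

variable {n : ℕ} {Ω : Opens (EuclideanSpace ℝ (Fin n))}
  {F : Type*} [NormedAddCommGroup F] [NormedSpace ℝ F] {p : ℝ≥0∞} [Fact (1 ≤ p)]

/-- The `L^p` class of a Sobolev function. -/
def fn : SobolevSpace Ω F p →L[ℝ]
    Lp F p (volume.restrict (Ω : Set (EuclideanSpace ℝ (Fin n)))) :=
  (WithLp.fstL p ℝ _ _).comp (SobolevSpace Ω F p).subtypeL

/-- The weak gradient `Du` of a Sobolev function `u`. -/
def grad : SobolevSpace Ω F p →L[ℝ]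
    Lp (Grad n F) p (volume.restrict (Ω : Set (EuclideanSpace ℝ (Fin n)))) :=
  (WithLp.sndL p ℝ _ _).comp (SobolevSpace Ω F p).subtypeL

theorem isWeakGradient (u : SobolevSpace Ω F p) : IsWeakGradient Ω (fn u) (grad u) := u.2

/-- The trace `∑ i, (Dᵢ φ)ᵢ` of the matrix of partial derivatives of an `ℝⁿ`-valued function. -/
def matTrace (n : ℕ) : Grad n (EuclideanSpace ℝ (Fin n)) →L[ℝ] ℝ :=
  ∑ i : Fin n, (EuclideanSpace.proj i : EuclideanSpace ℝ (Fin n) →L[ℝ] ℝ).comp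
    (PiLp.proj (𝕜 := ℝ) 2 (fun _ : Fin n => EuclideanSpace ℝ (Fin n)) i)

@[simp] theorem matTrace_apply (A : Grad n (EuclideanSpace ℝ (Fin n))) :
    matTrace n A = ∑ i, A i i := by
  simp [matTrace]

/-- The divergence `div φ = ∑ i, ∂ᵢ φⁱ` of a Sobolev vector field `φ`. -/
def divergence : SobolevSpace Ω (EuclideanSpace ℝ (Fin n)) p →L[ℝ]
    Lp ℝ p (volume.restrict (Ω : Set (EuclideanSpace ℝ (Fin n)))) :=
  ((matTrace n).compLpL p _).comp grad

end SobolevSpace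

/-- The inclusion `L^p(μ) → L^1(μ)` for a finite measure `μ` and `1 ≤ p`. -/
def lpToL1 {α F : Type*} [MeasurableSpace α] [NormedAddCommGroup F] [NormedSpace ℝ F]
    (p : ℝ≥0∞) [hp : Fact (1 ≤ p)] (μ : Measure α) [IsFiniteMeasure μ] :
    Lp F p μ →L[ℝ] Lp F 1 μ :=
  LinearMap.mkContinuous
    { toFun := fun f => ((Lp.memLp f).mono_exponent hp.out).toLp f
      map_add' := fun f g => by
        rw [← MemLp.toLp_add]
        exact MemLp.toLp_congr _ _ (Lp.coeFn_add f g)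
      map_smul' := fun c f => by
        rw [RingHom.id_apply, ← MemLp.toLp_const_smul]
        exact MemLp.toLp_congr _ _ (Lp.coeFn_smul c f) }
    (μ Set.univ ^ (1 / (1 : ℝ≥0∞).toReal - 1 / p.toReal)).toReal
    (fun f => by
      have h := eLpNorm_le_eLpNorm_mul_rpow_measure_univ hp.out (Lp.aestronglyMeasurable f)
      have hq : (0 : ℝ) ≤ 1 / (1 : ℝ≥0∞).toReal - 1 / p.toReal := by
        rcases eq_or_ne p ∞ with rfl | h'
        · simp
        · have : 1 ≤ p.toReal := by
            simpa using ENNReal.toReal_mono h' hp.out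
          simp only [ENNReal.toReal_one, div_one, one_div, sub_nonneg]
          exact inv_le_one_of_one_le₀ this
      have hfin : μ Set.univ ^ (1 / (1 : ℝ≥0∞).toReal - 1 / p.toReal) ≠ ∞ :=
        ENNReal.rpow_ne_top_of_nonneg hq (measure_ne_top _ _)
      change ‖((Lp.memLp f).mono_exponent hp.out).toLp f‖ ≤ _
      rw [Lp.norm_toLp, Lp.norm_def, ← ENNReal.toReal_mul, mul_comm]
      exact ENNReal.toReal_mono (ENNReal.mul_ne_top (Lp.eLpNorm_ne_top f) hfin) h)

theorem coeFn_lpToL1 {α F : Type*} [MeasurableSpace α] [NormedAddCommGroup F] [NormedSpace ℝ F]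
    (p : ℝ≥0∞) [hp : Fact (1 ≤ p)] (μ : Measure α) [IsFiniteMeasure μ] (f : Lp F p μ) :
    lpToL1 p μ f =ᵐ[μ] f :=
  MemLp.coeFn_toLp ((Lp.memLp f).mono_exponent hp.out)

namespace SobolevSpace

variable {n : ℕ} {Ω : Opens (EuclideanSpace ℝ (Fin n))}
  {F : Type*} [NormedAddCommGroup F] [NormedSpace ℝ F] {p : ℝ≥0∞} [Fact (1 ≤ p)]

theorem isFiniteMeasure_restrict
    (hΩ : Bornology.IsBounded (Ω : Set (EuclideanSpace ℝ (Fin n)))) :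
    IsFiniteMeasure (volume.restrict (Ω : Set (EuclideanSpace ℝ (Fin n)))) :=
  ⟨by simpa using hΩ.measure_lt_top⟩

/-- A continuous linear map into `W^{1,q}(Ω, F)` from its two components. -/
def mkCLM {q : ℝ≥0∞} [Fact (1 ≤ q)] {X : Type*} [NormedAddCommGroup X] [NormedSpace ℝ X]
    (A : X →L[ℝ] Lp F q (volume.restrict (Ω : Set (EuclideanSpace ℝ (Fin n)))))
    (B : X →L[ℝ] Lp (Grad n F) q (volume.restrict (Ω : Set (EuclideanSpace ℝ (Fin n)))))
    (h : ∀ x, IsWeakGradient Ω (A x) (B x)) : X →L[ℝ] SobolevSpace Ω F q :=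
  ((WithLp.prodContinuousLinearEquiv q ℝ _ _).symm.toContinuousLinearMap.comp
    (A.prod B)).codRestrict (SobolevSpace Ω F q) h

/-- The continuous embedding `W^{1,p}(Ω) ↪ W^{1,1}(Ω)` for bounded `Ω`. -/
def toW11 (hΩ : Bornology.IsBounded (Ω : Set (EuclideanSpace ℝ (Fin n)))) :
    SobolevSpace Ω F p →L[ℝ] SobolevSpace Ω F 1 :=
  haveI := isFiniteMeasure_restrict hΩ
  mkCLM ((lpToL1 p (volume.restrict (Ω : Set (EuclideanSpace ℝ (Fin n))))).comp fn)
    ((lpToL1 p (volume.restrict (Ω : Set (EuclideanSpace ℝ (Fin n))))).comp grad)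
    (fun u => (isWeakGradient u).congr_ae (coeFn_lpToL1 p _ (fn u)) (coeFn_lpToL1 p _ (grad u)))

theorem fn_toW11 (hΩ : Bornology.IsBounded (Ω : Set (EuclideanSpace ℝ (Fin n))))
    (u : SobolevSpace Ω F p) :
    fn (toW11 hΩ u) =ᵐ[volume.restrict (Ω : Set (EuclideanSpace ℝ (Fin n)))] fn u :=
  haveI := isFiniteMeasure_restrict hΩ
  coeFn_lpToL1 p _ (fn u)

theorem grad_toW11 (hΩ : Bornology.IsBounded (Ω : Set (EuclideanSpace ℝ (Fin n))))
    (u : SobolevSpace Ω F p) :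
    grad (toW11 hΩ u) =ᵐ[volume.restrict (Ω : Set (EuclideanSpace ℝ (Fin n)))] grad u :=
  haveI := isFiniteMeasure_restrict hΩ
  coeFn_lpToL1 p _ (grad u)

end SobolevSpace

open SobolevSpace

/-- The trace operator `T : W^{1,1}(Ω) → W^{1,∞}(Ω, ℝⁿ)^*`, the continuous linear operator with
`⟨Tf, φ⟩ = ∫_Ω f div φ dx + ∫_Ω φ · Df dx`; see `traceOp_apply`. -/
def traceOp {n : ℕ} (Ω : Opens (EuclideanSpace ℝ (Fin n))) :
    SobolevSpace Ω ℝ 1 →L[ℝ] StrongDual ℝ (SobolevSpace Ω (EuclideanSpace ℝ (Fin n)) ∞) :=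
  (((ContinuousLinearMap.mul ℝ ℝ).lpPairing
      (volume.restrict (Ω : Set (EuclideanSpace ℝ (Fin n)))) 1 ∞).bilinearComp fn divergence) +
  (((innerSL ℝ (E := EuclideanSpace ℝ (Fin n))).lpPairing
      (volume.restrict (Ω : Set (EuclideanSpace ℝ (Fin n)))) 1 ∞).bilinearComp grad fn)

theorem traceOp_apply {n : ℕ} (Ω : Opens (EuclideanSpace ℝ (Fin n)))
    (f : SobolevSpace Ω ℝ 1) (φ : SobolevSpace Ω (EuclideanSpace ℝ (Fin n)) ∞) :
    traceOp Ω f φ =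
      (∫ x in (Ω : Set (EuclideanSpace ℝ (Fin n))), fn f x * divergence φ x) +
      ∫ x in (Ω : Set (EuclideanSpace ℝ (Fin n))), inner ℝ (fn φ x) (grad f x) := by
  simp only [traceOp, add_apply, ContinuousLinearMap.bilinearComp_apply,
    ContinuousLinearMap.lpPairing_eq_integral, ContinuousLinearMap.mul_apply']
  congr 1
  refine integral_congr_ae (.of_forall fun x => ?_)
  exact real_inner_comm (fn φ x) (grad f x : EuclideanSpace ℝ (Fin n))

/-- `f ∈ W^{1,p}(Ω)` is a weak solution of the boundary value problem
`-div (|Df|^{p-2} Df) = g` on `Ω`, `f = f_b` on `∂Ω`: we have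
`∫_Ω |Df|^{p-2} Df · Dψ - g ψ dx = 0` for all `ψ ∈ C_c^∞(Ω)`, and
`⟨T (f - f_b), φ⟩ = 0` for all `φ ∈ W^{1,∞}(Ω, ℝⁿ)`. -/
def IsWeakSolutionPLaplace {n : ℕ} {Ω : Opens (EuclideanSpace ℝ (Fin n))}
    (hΩ : Bornology.IsBounded (Ω : Set (EuclideanSpace ℝ (Fin n))))
    {p p' : ℝ≥0∞} [Fact (1 ≤ p)]
    (g : Lp ℝ p' (volume.restrict (Ω : Set (EuclideanSpace ℝ (Fin n)))))
    (f_b f : SobolevSpace Ω ℝ p) : Prop :=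
  (∀ ψ : 𝓓(Ω, ℝ),
    ∫ x in (Ω : Set (EuclideanSpace ℝ (Fin n))),
      (‖grad f x‖ ^ (p.toReal - 2) * inner ℝ (grad f x) (gradient ψ x) - g x * ψ x) = 0) ∧
  (∀ φ : SobolevSpace Ω (EuclideanSpace ℝ (Fin n)) ∞, traceOp Ω (toW11 hΩ (f - f_b)) φ = 0)

end

/-! The solution is found by the direct method. It minimises the energy `(1/p) ∫ |Df|^p - ∫ g f` on
the coset `f_b + W^{1,p}_0(Ω)`, where `W^{1,p}_0(Ω)` is the closure of the test functions in
`W^{1,p}(Ω)`. Differentiating the energy at the minimiser along a test function gives the weak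
equation. The boundary condition holds because the trace operator is continuous and vanishes on test
functions, hence on `W^{1,p}_0(Ω)`; no regularity of the boundary enters.

Existence of the minimiser uses uniform convexity in place of weak compactness. The source term is
linear, so the midpoint defect of the energy is exactly that of `‖Df‖_p^p / p`
(`rpowEnergy_midpoint`). Along a minimising sequence this defect tends to zero, and
`normRpowUniformlyConvex_Lp` turns that into the Cauchy property for the gradients. Poincaré's
inequality (`exists_norm_fn_le_norm_grad`) passes it on to the functions, and `W^{1,p}(Ω)` is
complete. The same inequality bounds the energy from below. This argument is `exists_rpowEnergy_le`,
stated for an abstract operator `A` in place of the gradient.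

Uniform convexity of `L^p` is integrated from a pointwise inequality on a finite-dimensional space,
`exists_norm_sub_rpow_le_add_gap`, which follows from compactness and homogeneity and treats all `1
< p < ∞` at once. -/

/-! ### Poincaré's inequality for smooth functions -/

/-- Poincaré's inequality in a strip for compactly supported `C¹` functions. -/
theorem integral_abs_rpow_le_integral_abs_fderiv_rpow {n : ℕ} {p R : ℝ} (hp : 1 < p) (hR : 0 ≤ R)
    (i : Fin n) {u : EuclideanSpace ℝ (Fin n) → ℝ} (hu : ContDiff ℝ 1 u)
    (hc : HasCompactSupport u) (hsupp : ∀ x, u x ≠ 0 → |x i| ≤ R) :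
    ∫ x, |u x| ^ p ≤
      (p * R) ^ p * ∫ x, |fderiv ℝ u x (EuclideanSpace.single i 1)| ^ p := by
  have hp0 : 0 < p := one_pos.trans hp
  set v : EuclideanSpace ℝ (Fin n) := EuclideanSpace.single i 1 with hv
  set π : EuclideanSpace ℝ (Fin n) →L[ℝ] ℝ := EuclideanSpace.proj i with hπ
  have hg : ContDiff ℝ 1 (fun x => |u x| ^ p) := hu.norm_rpow hp
  have hgc : HasCompactSupport (fun x => |u x| ^ p) :=
    hc.comp_left (g := fun t : ℝ => |t| ^ p) (by simp [hp0.ne'])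
  have hdu : Continuous fun x => fderiv ℝ u x v :=
    (hu.continuous_fderiv (by simp)).clm_apply continuous_const
  have hduc : HasCompactSupport fun x => fderiv ℝ u x v := hc.fderiv_apply ℝ _
  have hdg : Continuous fun x => fderiv ℝ (fun x => |u x| ^ p) x v :=
    (hg.continuous_fderiv (by simp)).clm_apply continuous_const
  have hdgc : HasCompactSupport fun x => fderiv ℝ (fun x => |u x| ^ p) x v := hgc.fderiv_apply ℝ _
  have hI : Integrable (fun x => |u x| ^ p) := hg.continuous.integrable_of_hasCompactSupport hgc
  have hJ : Integrable (fun x => |fderiv ℝ u x v| ^ p) :=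
    (hdu.abs.rpow_const fun _ => Or.inr hp0.le).integrable_of_hasCompactSupport
      (hduc.comp_left (g := fun t : ℝ => |t| ^ p) (by simp [hp0.ne']))
  have hfπ : ∀ x, fderiv ℝ π x v = 1 := fun x => by
    rw [π.fderiv]
    simp [hπ, hv]
  have hK : Integrable (fun x => π x * fderiv ℝ (fun x => |u x| ^ p) x v) :=
    (π.continuous.mul hdg).integrable_of_hasCompactSupport hdgc.mul_left
  -- The coordinate `x i` has derivative `1` along `v`, so integrating by parts against it gives `∫
  -- |u|^p = -∫ x_i ∂_i(|u|^p)`.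
  have parts := integral_mul_fderiv_eq_neg_fderiv_mul_of_integrable (μ := volume)
    (f := π) (g := fun x => |u x| ^ p) (v := v) (by simpa only [hfπ, one_mul] using hI) hK
    ((π.continuous.mul hg.continuous).integrable_of_hasCompactSupport hgc.mul_left)
    (fun x _ => π.differentiableAt) (fun x _ => hg.differentiable (by simp) x)
  simp only [hfπ, one_mul] at parts
  have hdg' : ∀ x, fderiv ℝ (fun x => |u x| ^ p) x v = p * |u x| ^ (p - 2) * u x *
      fderiv ℝ u x v := fun x => by
    have h := ((hasDerivAt_abs_rpow (u x) hp).comp_hasFDerivAt x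
      (hu.differentiable (by simp) x).hasFDerivAt).fderiv
    have h' : (fun x => |u x| ^ p) = (fun t : ℝ => |t| ^ p) ∘ u := rfl
    rw [h', h]
    simp
  set q := p.conjExponent with hq
  have hpq : p.HolderConjugate q := .conjExponent hp
  -- Young's inequality for `|u|^(p-1)` and `p R |∂_i u|`. The `|u|^p / q` term is later absorbed on
  -- the left, where `1 - 1/q = 1/p` remains.
  have hpt : ∀ x, -(π x * fderiv ℝ (fun x => |u x| ^ p) x v) ≤
      |u x| ^ p / q + (p * R) ^ p * |fderiv ℝ u x v| ^ p / p := fun x => by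
    rw [hdg']
    rcases eq_or_ne (u x) 0 with h0 | h0
    · simp only [h0, mul_zero, zero_mul, neg_zero, abs_zero, Real.zero_rpow hp0.ne', zero_div,
        zero_add]
      positivity
    · have hpos : 0 < |u x| := abs_pos.2 h0
      have y := Real.young_inequality_of_nonneg (a := |u x| ^ (p - 1))
        (b := p * R * |fderiv ℝ u x v|) (p := q) (q := p) (by positivity) (by positivity) hpq.symm
      rw [← Real.rpow_mul hpos.le, Real.mul_rpow (by positivity) (by positivity),
        hpq.sub_one_mul_conj] at y
      refine le_trans ?_ y
      have e : |u x| ^ (p - 1) = |u x| ^ (p - 2) * |u x| := by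
        rw [← Real.rpow_add_one hpos.ne']; ring_nf
      have hx : |π x| ≤ R := hsupp x h0
      calc _ ≤ |π x * (p * |u x| ^ (p - 2) * u x * fderiv ℝ u x v)| := neg_le_abs _
        _ = |π x| * (p * |u x| ^ (p - 2) * |u x| * |fderiv ℝ u x v|) := by
          simp only [abs_mul, abs_of_pos hp0, abs_of_pos (Real.rpow_pos_of_pos hpos (p - 2))]
        _ ≤ R * (p * |u x| ^ (p - 2) * |u x| * |fderiv ℝ u x v|) := by gcongr
        _ = _ := by rw [e]; ring
  have key := integral_mono hK.neg ((hI.div_const q).add ((hJ.const_mul ((p * R) ^ p)).div_const p))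
    hpt
  simp only [Pi.neg_apply, Pi.add_apply] at key
  rw [integral_neg, parts, neg_neg, integral_add (hI.div_const q)
    ((hJ.const_mul ((p * R) ^ p)).div_const p), integral_div, integral_div,
    integral_const_mul] at key
  have e1 : q⁻¹ = 1 - p⁻¹ := by linarith [hpq.inv_add_inv_eq_one]
  rw [div_eq_mul_inv, e1] at key
  have : (∫ x, |u x| ^ p) / p ≤
      ((p * R) ^ p * ∫ x, |fderiv ℝ u x v| ^ p) / p := by
    rw [div_eq_mul_inv]; linarith
  exact (div_le_div_iff_of_pos_right hp0).1 this

/-! ### Uniform convexity of powers of a norm in finite dimension -/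

/-- The convexity defect of `‖·‖ ^ p` at the midpoint of `a` and `b`. -/
noncomputable def rpowMidpointGap {E : Type*} [NormedAddCommGroup E] [NormedSpace ℝ E] (p : ℝ) (a b : E) : ℝ :=
  (‖a‖ ^ p + ‖b‖ ^ p) / 2 - ‖(2⁻¹ : ℝ) • (a + b)‖ ^ p

section Gap

variable {E : Type*} [NormedAddCommGroup E] [NormedSpace ℝ E] {p : ℝ}

theorem norm_midpoint_rpow_le (hp : 1 ≤ p) (a b : E) :
    ‖(2⁻¹ : ℝ) • (a + b)‖ ^ p ≤ ((‖a‖ + ‖b‖) / 2) ^ p := by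
  refine Real.rpow_le_rpow (norm_nonneg _) ?_ (by linarith)
  rw [norm_smul, Real.norm_of_nonneg (by positivity)]
  linarith [norm_add_le a b]

theorem half_add_rpow_le (hp : 1 ≤ p) {s t : ℝ} (hs : 0 ≤ s) (ht : 0 ≤ t) :
    ((s + t) / 2) ^ p ≤ (s ^ p + t ^ p) / 2 := by
  have := (convexOn_rpow hp).2 hs ht (by norm_num : (0 : ℝ) ≤ 1 / 2)
    (by norm_num : (0 : ℝ) ≤ 1 / 2) (by norm_num)
  simp only [smul_eq_mul] at this
  have e : (s + t) / 2 = 1 / 2 * s + 1 / 2 * t := by ring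
  rw [e]
  linarith

theorem rpowMidpointGap_nonneg (hp : 1 ≤ p) (a b : E) : 0 ≤ rpowMidpointGap p a b :=
  sub_nonneg.2 ((norm_midpoint_rpow_le hp a b).trans
    (half_add_rpow_le hp (norm_nonneg a) (norm_nonneg b)))

/-- A zero gap forces equality both in the triangle inequality and in the convexity of `t ^ p`. The
latter gives equal norms, the former then a common ray by strict convexity of the space. -/
theorem eq_of_rpowMidpointGap_eq_zero [StrictConvexSpace ℝ E] (hp : 1 < p) {a b : E}
    (h : rpowMidpointGap p a b = 0) : a = b := by
  have h1 := norm_midpoint_rpow_le hp.le a b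
  have h2 := half_add_rpow_le hp.le (norm_nonneg a) (norm_nonneg b)
  rw [rpowMidpointGap, sub_eq_zero] at h
  have hab : ‖a‖ = ‖b‖ := by
    by_contra hne
    have := (strictConvexOn_rpow hp).2 (norm_nonneg a) (norm_nonneg b) hne
      (by norm_num : (0 : ℝ) < 1 / 2) (by norm_num : (0 : ℝ) < 1 / 2) (by norm_num)
    simp only [smul_eq_mul] at this
    have e : 1 / 2 * ‖a‖ + 1 / 2 * ‖b‖ = (‖a‖ + ‖b‖) / 2 := by ring
    rw [e] at this
    linarith
  have h3 : ‖(2⁻¹ : ℝ) • (a + b)‖ ^ p = ((‖a‖ + ‖b‖) / 2) ^ p := by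
    refine le_antisymm h1 ?_
    rw [← h]; exact h2
  have h4 := (Real.rpow_left_inj (norm_nonneg _) (by positivity) (by linarith)).1 h3
  rw [norm_smul, Real.norm_of_nonneg (by positivity)] at h4
  have h5 : ‖a + b‖ = ‖a‖ + ‖b‖ := by linarith
  exact (sameRay_iff_of_norm_eq hab).1 (sameRay_iff_norm_add.2 h5)

theorem rpowMidpointGap_smul {c : ℝ} (hc : 0 ≤ c) (a b : E) :
    rpowMidpointGap p (c • a) (c • b) = c ^ p * rpowMidpointGap p a b := by
  have e : (2⁻¹ : ℝ) • (c • a + c • b) = c • ((2⁻¹ : ℝ) • (a + b)) := by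
    rw [← smul_add, smul_comm]
  rw [rpowMidpointGap, rpowMidpointGap, e]
  rw [norm_smul c, norm_smul c, norm_smul c, Real.norm_of_nonneg hc,
    Real.mul_rpow hc (norm_nonneg _), Real.mul_rpow hc (norm_nonneg _),
    Real.mul_rpow hc (norm_nonneg _)]
  ring

theorem continuous_rpowMidpointGap (hp : 0 ≤ p) :
    Continuous fun z : E × E => rpowMidpointGap p z.1 z.2 := by
  unfold rpowMidpointGap
  have := fun f : E × E → E => fun hf : Continuous f =>
    hf.norm.rpow_const (p := p) fun _ => Or.inr hp
  exact (((this _ continuous_fst).add (this _ continuous_snd)).div_const 2).sub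
    (this _ (by fun_prop))

/-- Quantitative uniform convexity of `‖·‖ ^ p` on a finite-dimensional strictly convex space. -/
theorem exists_norm_sub_rpow_le_add_gap [FiniteDimensional ℝ E] [StrictConvexSpace ℝ E]
    (hp : 1 < p) {ε : ℝ} (hε : 0 < ε) :
    ∃ C, 0 ≤ C ∧ ∀ a b : E,
      ‖a - b‖ ^ p ≤ ε * (‖a‖ ^ p + ‖b‖ ^ p) + C * rpowMidpointGap p a b := by
  have hp0 : 0 < p := one_pos.trans hp
  have : ProperSpace E := FiniteDimensional.proper ℝ E
  have hcont := fun f : E × E → E => fun hf : Continuous f =>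
    hf.norm.rpow_const (p := p) fun _ => Or.inr hp0.le
  have hdist := hcont (fun z => z.1 - z.2) (by fun_prop)
  -- By homogeneity it suffices to treat the normalised pairs. Those violating the bound with `C =
  -- 0` lie in this compact set, which misses the diagonal, so the gap has a positive minimum there.
  set K : Set (E × E) := {z | ‖z.1‖ ^ p + ‖z.2‖ ^ p = 1 ∧ ε ≤ ‖z.1 - z.2‖ ^ p} with hK
  have hbd : ∀ z : E × E, ‖z.1‖ ^ p + ‖z.2‖ ^ p = 1 → ‖z.1‖ ≤ 1 ∧ ‖z.2‖ ≤ 1 := fun z hz => by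
    have h1 := Real.rpow_nonneg (norm_nonneg z.1) p
    have h2 := Real.rpow_nonneg (norm_nonneg z.2) p
    constructor
    · refine (Real.rpow_le_rpow_iff (norm_nonneg _) zero_le_one hp0).1 ?_
      rw [Real.one_rpow]; linarith
    · refine (Real.rpow_le_rpow_iff (norm_nonneg _) zero_le_one hp0).1 ?_
      rw [Real.one_rpow]; linarith
  have hKc : IsCompact K := by
    refine Metric.isCompact_of_isClosed_isBounded ?_ ?_
    · exact (isClosed_eq ((hcont _ continuous_fst).add (hcont _ continuous_snd))
        continuous_const).inter (isClosed_le continuous_const hdist)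
    · refine (Metric.isBounded_closedBall (x := (0 : E × E)) (r := 1)).subset fun z hz => ?_
      rw [mem_closedBall_zero_iff, Prod.norm_def]
      exact max_le (hbd z hz.1).1 (hbd z hz.1).2
  obtain ⟨δ, hδ, hδK⟩ : ∃ δ > 0, ∀ z ∈ K, δ ≤ rpowMidpointGap p z.1 z.2 := by
    rcases K.eq_empty_or_nonempty with h | h
    · exact ⟨1, one_pos, by simp [h]⟩
    · obtain ⟨z, hz, hmin⟩ := hKc.exists_isMinOn h (continuous_rpowMidpointGap hp0.le).continuousOn
      refine ⟨_, lt_of_le_of_ne (rpowMidpointGap_nonneg hp.le z.1 z.2) fun h0 => ?_,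
        fun w hw => hmin hw⟩
      have := hz.2
      rw [eq_of_rpowMidpointGap_eq_zero hp h0.symm, sub_self, norm_zero,
        Real.zero_rpow hp0.ne'] at this
      linarith
  have hsphere : ∀ a b : E, ‖a‖ ^ p + ‖b‖ ^ p = 1 →
      ‖a - b‖ ^ p ≤ ε + 2 ^ p / δ * rpowMidpointGap p a b := fun a b hab => by
    have hg := rpowMidpointGap_nonneg hp.le a b
    rcases le_total (‖a - b‖ ^ p) ε with h | h
    · have : 0 ≤ 2 ^ p / δ * rpowMidpointGap p a b := by positivity
      linarith
    · have h1 := hδK (a, b) ⟨hab, h⟩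
      have h2 : ‖a - b‖ ^ p ≤ 2 ^ p :=
        Real.rpow_le_rpow (norm_nonneg _)
          ((norm_sub_le a b).trans (by linarith [(hbd (a, b) hab).1, (hbd (a, b) hab).2])) hp0.le
      have h3 : 2 ^ p / δ * δ ≤ 2 ^ p / δ * rpowMidpointGap p a b := by gcongr
      rw [div_mul_cancel₀ _ hδ.ne'] at h3
      linarith
  refine ⟨2 ^ p / δ, by positivity, fun a b => ?_⟩
  have hs : 0 ≤ ‖a‖ ^ p + ‖b‖ ^ p := by positivity
  rcases hs.eq_or_lt with h0 | hpos
  · have h1 := Real.rpow_nonneg (norm_nonneg a) p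
    have h2 := Real.rpow_nonneg (norm_nonneg b) p
    have ha : a = 0 := by
      simpa using (Real.rpow_eq_zero (norm_nonneg a) hp0.ne').1 (by linarith)
    have hb : b = 0 := by
      simpa using (Real.rpow_eq_zero (norm_nonneg b) hp0.ne').1 (by linarith)
    simp [ha, hb, rpowMidpointGap, Real.zero_rpow hp0.ne']
  · set s := ‖a‖ ^ p + ‖b‖ ^ p
    -- The scaling that makes the sum of the `p`-th powers equal to `1`.
    set c := (s ^ p⁻¹)⁻¹ with hc
    have hcpos : 0 < c := by positivity
    have hcp : c ^ p = s⁻¹ := by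
      rw [hc, Real.inv_rpow (by positivity), Real.rpow_inv_rpow hs hp0.ne']
    have h := hsphere (c • a) (c • b) (by
      simp only [norm_smul, Real.norm_of_nonneg hcpos.le, Real.mul_rpow hcpos.le (norm_nonneg _),
        hcp]
      rw [← mul_add, inv_mul_cancel₀ hpos.ne'])
    rw [← smul_sub, norm_smul, Real.norm_of_nonneg hcpos.le,
      Real.mul_rpow hcpos.le (norm_nonneg _), rpowMidpointGap_smul hcpos.le, hcp] at h
    have h' := mul_le_mul_of_nonneg_left h hs
    rw [← mul_assoc, mul_inv_cancel₀ hpos.ne', one_mul] at h'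
    refine h'.trans (le_of_eq ?_)
    field_simp

end Gap

/-! ### Classical gradients and test functions -/

theorem gradient_apply_eq_fderiv_single {n : ℕ} (u : EuclideanSpace ℝ (Fin n) → ℝ)
    (x : EuclideanSpace ℝ (Fin n)) (i : Fin n) :
    gradient u x i = fderiv ℝ u x (EuclideanSpace.single i 1) := by
  rw [← inner_gradient_left, EuclideanSpace.inner_single_right]
  simp

theorem ContDiff.continuous_gradient {n : ℕ} {u : EuclideanSpace ℝ (Fin n) → ℝ}
    (hu : ContDiff ℝ 1 u) : Continuous (gradient u) :=
  (InnerProductSpace.toDual ℝ (EuclideanSpace ℝ (Fin n))).symm.continuous.comp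
    (hu.continuous_fderiv (by simp))

theorem HasCompactSupport.gradient {n : ℕ} {u : EuclideanSpace ℝ (Fin n) → ℝ}
    (hu : HasCompactSupport u) : HasCompactSupport (gradient u) :=
  (hu.fderiv ℝ).comp_left (map_zero (InnerProductSpace.toDual ℝ (EuclideanSpace ℝ (Fin n))).symm)

theorem gradient_add_of_contDiff {n : ℕ} {u v : EuclideanSpace ℝ (Fin n) → ℝ}
    (hu : ContDiff ℝ 1 u) (hv : ContDiff ℝ 1 v) :
    gradient (u + v) = gradient u + gradient v := by
  ext1 x
  simp only [gradient, Pi.add_apply]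
  rw [fderiv_add (hu.differentiable (by simp) x) (hv.differentiable (by simp) x), map_add]

theorem gradient_smul_of_contDiff {n : ℕ} (c : ℝ) {u : EuclideanSpace ℝ (Fin n) → ℝ}
    (hu : ContDiff ℝ 1 u) : gradient (c • u) = c • gradient u := by
  ext1 x
  simp only [gradient, Pi.smul_apply]
  rw [fderiv_const_smul (hu.differentiable (by simp) x), map_smul]

namespace TestFunction

variable {n : ℕ} {Ω : Opens (EuclideanSpace ℝ (Fin n))}

theorem contDiff_one (ψ : 𝓓(Ω, ℝ)) : ContDiff ℝ 1 ψ := ψ.contDiff.of_le (by simp)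

theorem eq_zero_of_notMem (ψ : 𝓓(Ω, ℝ)) {x : EuclideanSpace ℝ (Fin n)} (hx : x ∉ Ω) : ψ x = 0 :=
  image_eq_zero_of_notMem_tsupport fun h => hx (ψ.tsupport_subset h)

theorem gradient_eq_zero_of_notMem (ψ : 𝓓(Ω, ℝ)) {x : EuclideanSpace ℝ (Fin n)} (hx : x ∉ Ω) :
    gradient ψ x = 0 := by
  have : fderiv ℝ ψ x = 0 := by
    by_contra h
    exact hx (ψ.tsupport_subset (support_fderiv_subset ℝ h))
  simp [gradient, this]

theorem memLp (ψ : 𝓓(Ω, ℝ)) (p : ℝ≥0∞) :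
    MemLp ψ p (volume.restrict (Ω : Set (EuclideanSpace ℝ (Fin n)))) :=
  ψ.continuous.memLp_of_hasCompactSupport ψ.hasCompactSupport

theorem memLp_gradient (ψ : 𝓓(Ω, ℝ)) (p : ℝ≥0∞) :
    MemLp (gradient ψ) p (volume.restrict (Ω : Set (EuclideanSpace ℝ (Fin n)))) :=
  ψ.contDiff_one.continuous_gradient.memLp_of_hasCompactSupport ψ.hasCompactSupport.gradient

/-- Both integrands vanish outside `Ω`, so this is integration by parts on the whole space, with no
boundary term. -/
theorem isWeakGradient_gradient (ψ : 𝓓(Ω, ℝ)) : IsWeakGradient Ω ψ (gradient ψ) := by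
  intro η i
  rw [setIntegral_eq_integral_of_forall_compl_eq_zero fun x hx => by
      rw [ψ.eq_zero_of_notMem hx, smul_zero],
    setIntegral_eq_integral_of_forall_compl_eq_zero fun x hx => by
      rw [ψ.gradient_eq_zero_of_notMem hx]; simp]
  simp only [gradient_apply_eq_fderiv_single]
  have hd : ∀ ρ : 𝓓(Ω, ℝ), Continuous fun x => fderiv ℝ ρ x (EuclideanSpace.single i 1) :=
    fun ρ => (ρ.contDiff_one.continuous_fderiv (by simp)).clm_apply continuous_const
  have hdc : HasCompactSupport fun x => fderiv ℝ η x (EuclideanSpace.single i 1) :=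
    η.hasCompactSupport.fderiv_apply ℝ _
  rw [integral_smul_fderiv_eq_neg_fderiv_smul_of_integrable (𝕜 := ℝ), neg_neg]
  · exact ((hd η).smul ψ.continuous).integrable_of_hasCompactSupport hdc.smul_right
  · exact (η.continuous.smul (hd ψ)).integrable_of_hasCompactSupport
      η.hasCompactSupport.smul_right
  · exact (η.continuous.smul ψ.continuous).integrable_of_hasCompactSupport
      η.hasCompactSupport.smul_right
  · exact fun x _ => η.contDiff_one.differentiable (by simp) x
  · exact fun x _ => ψ.contDiff_one.differentiable (by simp) x

end TestFunction

/-! ### The space `W^{1,p}_0(Ω)`, its traces, completeness and Poincaré's inequality -/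

namespace SobolevSpace

variable {n : ℕ} {Ω : Opens (EuclideanSpace ℝ (Fin n))}
  {F : Type*} [NormedAddCommGroup F] [NormedSpace ℝ F] {p : ℝ≥0∞} [Fact (1 ≤ p)]

theorem ext_fn_grad {u v : SobolevSpace Ω F p} (h₁ : fn u = fn v) (h₂ : grad u = grad v) :
    u = v :=
  Subtype.ext (WithLp.ofLp_injective p (Prod.ext h₁ h₂))

/-- Test functions as elements of the Sobolev space. -/
noncomputable def ofTestFunction : 𝓓(Ω, ℝ) →ₗ[ℝ] SobolevSpace Ω ℝ p where
  toFun ψ := ⟨WithLp.toLp p ((ψ.memLp p).toLp ψ, (ψ.memLp_gradient p).toLp (gradient ψ)),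
    ψ.isWeakGradient_gradient.congr_ae (ψ.memLp p).coeFn_toLp (ψ.memLp_gradient p).coeFn_toLp⟩
  map_add' ψ η := ext_fn_grad
    (MemLp.toLp_add (ψ.memLp p) (η.memLp p))
    ((MemLp.toLp_congr ((ψ + η).memLp_gradient p) ((ψ.memLp_gradient p).add (η.memLp_gradient p)) (.of_eq
      (gradient_add_of_contDiff ψ.contDiff_one η.contDiff_one))).trans
      (MemLp.toLp_add (ψ.memLp_gradient p) (η.memLp_gradient p)))
  map_smul' c ψ := ext_fn_grad
    (MemLp.toLp_const_smul c (ψ.memLp p))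
    ((MemLp.toLp_congr ((c • ψ).memLp_gradient p) ((ψ.memLp_gradient p).const_smul c) (.of_eq
      (gradient_smul_of_contDiff c ψ.contDiff_one))).trans
      (MemLp.toLp_const_smul c (ψ.memLp_gradient p)))

theorem fn_ofTestFunction (ψ : 𝓓(Ω, ℝ)) :
    fn (ofTestFunction ψ : SobolevSpace Ω ℝ p)
      =ᵐ[volume.restrict (Ω : Set (EuclideanSpace ℝ (Fin n)))] ψ :=
  (ψ.memLp p).coeFn_toLp

theorem grad_ofTestFunction (ψ : 𝓓(Ω, ℝ)) :
    grad (ofTestFunction ψ : SobolevSpace Ω ℝ p)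
      =ᵐ[volume.restrict (Ω : Set (EuclideanSpace ℝ (Fin n)))] gradient ψ :=
  (ψ.memLp_gradient p).coeFn_toLp

/-- The subspace `W^{1,p}_0(Ω)`: the closure of the test functions in `W^{1,p}(Ω)`. -/
noncomputable def zeroBoundary (Ω : Opens (EuclideanSpace ℝ (Fin n))) (p : ℝ≥0∞) [Fact (1 ≤ p)] :
    Submodule ℝ (SobolevSpace Ω ℝ p) :=
  (LinearMap.range (ofTestFunction (Ω := Ω) (p := p))).topologicalClosure

theorem ofTestFunction_mem_zeroBoundary (ψ : 𝓓(Ω, ℝ)) :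
    (ofTestFunction ψ : SobolevSpace Ω ℝ p) ∈ zeroBoundary Ω p :=
  Submodule.le_topologicalClosure _ ⟨ψ, rfl⟩

theorem zeroBoundary_induction {P : SobolevSpace Ω ℝ p → Prop} (hP : IsClosed {u | P u})
    (h : ∀ ψ : 𝓓(Ω, ℝ), P (ofTestFunction ψ)) {u : SobolevSpace Ω ℝ p}
    (hu : u ∈ zeroBoundary Ω p) : P u := by
  have : closure (Set.range (ofTestFunction (Ω := Ω) (p := p))) ⊆ {u | P u} :=
    closure_minimal (Set.range_subset_iff.2 h) hP
  exact this hu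

-- The `i`-th component of the weak gradient identity of `φ`, tested with `ψ` in direction `i`,
-- summed over `i`. It says that test functions have zero trace.
set_option maxHeartbeats 1000000 in
theorem integral_test_mul_divergence (ψ : 𝓓(Ω, ℝ))
    (φ : SobolevSpace Ω (EuclideanSpace ℝ (Fin n)) p) :
    (∫ x in (Ω : Set (EuclideanSpace ℝ (Fin n))), ψ x * divergence φ x) +
      ∫ x in (Ω : Set (EuclideanSpace ℝ (Fin n))), inner ℝ (fn φ x) (gradient ψ x) = 0 := by
  have hp : 1 ≤ p := Fact.out
  have i1 : ∀ i : Fin n, Integrable (fun x => ψ x • grad φ x i)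
      (volume.restrict (Ω : Set (EuclideanSpace ℝ (Fin n)))) := fun i =>
    (PiLp.proj (𝕜 := ℝ) 2 (fun _ : Fin n => EuclideanSpace ℝ (Fin n)) i).integrable_comp
      (integrable_smul_of_memLp hp ψ.continuous ψ.hasCompactSupport (Lp.memLp (grad φ)))
  have i2 : ∀ i : Fin n,
      Integrable (fun x => fderiv ℝ ψ x (EuclideanSpace.single i 1) • fn φ x)
      (volume.restrict (Ω : Set (EuclideanSpace ℝ (Fin n)))) := fun i =>
    integrable_smul_of_memLp hp
      ((ψ.contDiff_one.continuous_fderiv (by simp)).clm_apply continuous_const)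
      (ψ.hasCompactSupport.fderiv_apply ℝ _) (Lp.memLp (fn φ))
  have key : ∀ i : Fin n,
      ∫ x in (Ω : Set (EuclideanSpace ℝ (Fin n))),
        fderiv ℝ ψ x (EuclideanSpace.single i 1) * fn φ x i =
      - ∫ x in (Ω : Set (EuclideanSpace ℝ (Fin n))), ψ x * grad φ x i i := fun i => by
    have h := congrArg (EuclideanSpace.proj i : EuclideanSpace ℝ (Fin n) →L[ℝ] ℝ)
      (isWeakGradient φ ψ i)
    have h1 := ContinuousLinearMap.integral_comp_comm
      (EuclideanSpace.proj i : EuclideanSpace ℝ (Fin n) →L[ℝ] ℝ) (i1 i)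
    have h2 := ContinuousLinearMap.integral_comp_comm
      (EuclideanSpace.proj i : EuclideanSpace ℝ (Fin n) →L[ℝ] ℝ) (i2 i)
    rw [map_neg] at h
    exact h2.trans (h.trans (congrArg _ h1.symm))
  have j1 : ∀ i : Fin n, Integrable (fun x => ψ x * grad φ x i i)
      (volume.restrict (Ω : Set (EuclideanSpace ℝ (Fin n)))) := fun i =>
    (EuclideanSpace.proj i : EuclideanSpace ℝ (Fin n) →L[ℝ] ℝ).integrable_comp (i1 i)
  have j2 : ∀ i : Fin n,
      Integrable (fun x => fderiv ℝ ψ x (EuclideanSpace.single i 1) * fn φ x i)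
      (volume.restrict (Ω : Set (EuclideanSpace ℝ (Fin n)))) := fun i =>
    (EuclideanSpace.proj i : EuclideanSpace ℝ (Fin n) →L[ℝ] ℝ).integrable_comp (i2 i)
  have e1 : ∫ x in (Ω : Set (EuclideanSpace ℝ (Fin n))), ψ x * divergence φ x =
      ∑ i, ∫ x in (Ω : Set (EuclideanSpace ℝ (Fin n))), ψ x * grad φ x i i := by
    refine (integral_congr_ae ?_).trans (integral_finsetSum Finset.univ fun i _ => j1 i)
    filter_upwards [(matTrace n).coeFn_compLpL (grad φ)] with x hx
    have hx' : divergence φ x = matTrace n (grad φ x) := hx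
    rw [hx', matTrace_apply, Finset.mul_sum]
  have e2 : ∫ x in (Ω : Set (EuclideanSpace ℝ (Fin n))), inner ℝ (fn φ x) (gradient ψ x) =
      ∑ i, ∫ x in (Ω : Set (EuclideanSpace ℝ (Fin n))),
        fderiv ℝ ψ x (EuclideanSpace.single i 1) * fn φ x i := by
    refine (integral_congr_ae (.of_forall fun x => ?_)).trans
      (integral_finsetSum Finset.univ fun i _ => j2 i)
    refine (PiLp.inner_apply _ _).trans (Finset.sum_congr rfl fun i _ => ?_)
    rw [← gradient_apply_eq_fderiv_single]
    rfl
  rw [e1, e2, Finset.sum_congr rfl fun i _ => key i, Finset.sum_neg_distrib, add_neg_cancel]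

/-- The trace operator vanishes on `W^{1,p}_0(Ω)`. -/
theorem traceOp_toW11_eq_zero (hΩ : Bornology.IsBounded (Ω : Set (EuclideanSpace ℝ (Fin n))))
    {u : SobolevSpace Ω ℝ p} (hu : u ∈ zeroBoundary Ω p) : traceOp Ω (toW11 hΩ u) = 0 := by
  refine zeroBoundary_induction (P := fun u => traceOp Ω (toW11 hΩ u) = 0)
    (isClosed_eq ((traceOp Ω).continuous.comp (toW11 hΩ).continuous) continuous_const)
    (fun ψ => ?_) hu
  refine ContinuousLinearMap.ext fun φ => (traceOp_apply Ω _ φ).trans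
    (Eq.trans (congrArg₂ (· + ·) ?_ ?_) (integral_test_mul_divergence ψ φ))
  · refine integral_congr_ae ?_
    filter_upwards [fn_toW11 hΩ (ofTestFunction ψ : SobolevSpace Ω ℝ p),
      fn_ofTestFunction (p := p) ψ] with x h1 h2
    rw [h1, h2]
  · refine integral_congr_ae ?_
    filter_upwards [grad_toW11 hΩ (ofTestFunction ψ : SobolevSpace Ω ℝ p),
      grad_ofTestFunction (p := p) ψ] with x h1 h2
    exact congrArg (fun y : EuclideanSpace ℝ (Fin n) => inner ℝ (fn φ x) y) (h1.trans h2)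

/-- By Hölder, since `a` lies in the dual space `L^q`. This makes each weak gradient identity a
closed condition. -/
theorem continuous_integral_smul [CompleteSpace F] (q : ℝ≥0∞) [ENNReal.HolderConjugate q p]
    {μ : Measure (EuclideanSpace ℝ (Fin n))} [IsLocallyFiniteMeasure μ]
    {a : EuclideanSpace ℝ (Fin n) → ℝ} (ha : Continuous a) (hc : HasCompactSupport a) :
    Continuous fun u : Lp F p μ => ∫ x, a x • u x ∂μ := by
  have : Fact (1 ≤ q) := ⟨ENNReal.HolderConjugate.one_le q p⟩
  have hm : MemLp a q μ := ha.memLp_of_hasCompactSupport hc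
  refine ((ContinuousLinearMap.lsmul ℝ ℝ : ℝ →L[ℝ] F →L[ℝ] F).lpPairing μ q p
    (hm.toLp a)).continuous.congr fun u => ?_
  rw [ContinuousLinearMap.lpPairing_eq_integral]
  refine integral_congr_ae ?_
  filter_upwards [hm.coeFn_toLp] with x hx
  rw [hx, ContinuousLinearMap.lsmul_apply]

/-- The space is an intersection of equalisers of continuous maps, one for each test function and
direction; completeness is then inherited from `L^p`. -/
theorem isClosed_sobolevSpace (q : ℝ≥0∞) [ENNReal.HolderConjugate q p] :
    IsClosed (SobolevSpace Ω ℝ p : Set (WithLp p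
      (Lp ℝ p (volume.restrict (Ω : Set (EuclideanSpace ℝ (Fin n)))) ×
        Lp (Grad n ℝ) p (volume.restrict (Ω : Set (EuclideanSpace ℝ (Fin n))))))) := by
  have : (SobolevSpace Ω ℝ p : Set (WithLp p
      (Lp ℝ p (volume.restrict (Ω : Set (EuclideanSpace ℝ (Fin n)))) ×
        Lp (Grad n ℝ) p (volume.restrict (Ω : Set (EuclideanSpace ℝ (Fin n))))))) =
      ⋂ (ψ : 𝓓(Ω, ℝ)) (i : Fin n), {w |
        ∫ x in (Ω : Set (EuclideanSpace ℝ (Fin n))),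
          fderiv ℝ ψ x (EuclideanSpace.single i 1) • w.fst x =
        - ∫ x in (Ω : Set (EuclideanSpace ℝ (Fin n))), ψ x • w.snd x i} := by
    ext w
    simp only [Set.mem_iInter]
    rfl
  rw [this]
  refine isClosed_iInter fun ψ => isClosed_iInter fun i => isClosed_eq ?_ ?_
  · exact (continuous_integral_smul q
      ((ψ.contDiff_one.continuous_fderiv (by simp)).clm_apply continuous_const)
      (ψ.hasCompactSupport.fderiv_apply ℝ _)).comp (WithLp.fstL p ℝ _ _).continuous
  · set π : Grad n ℝ →L[ℝ] ℝ := PiLp.proj (𝕜 := ℝ) 2 (fun _ : Fin n => ℝ) i with hπ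
    refine (((continuous_integral_smul q ψ.continuous ψ.hasCompactSupport).comp
      (π.compLpL p (volume.restrict (Ω : Set (EuclideanSpace ℝ (Fin n))))).continuous).comp
      (WithLp.sndL p ℝ _ _).continuous).neg.congr fun w => ?_
    refine congrArg _ (integral_congr_ae ?_)
    filter_upwards [π.coeFn_compLpL w.snd] with x hx
    exact congrArg _ hx

theorem completeSpace (q : ℝ≥0∞) [ENNReal.HolderConjugate q p] :
    CompleteSpace (SobolevSpace Ω ℝ p) :=
  (isClosed_sobolevSpace q).completeSpace_coe

theorem norm_rpow_eq_integral {α E : Type*} [MeasurableSpace α] {μ : Measure α}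
    [NormedAddCommGroup E] (hp : p ≠ ∞) (f : Lp E p μ) :
    ‖f‖ ^ p.toReal = ∫ x, ‖f x‖ ^ p.toReal ∂μ := by
  have hp0 : p ≠ 0 := (one_pos.trans_le (Fact.out : 1 ≤ p)).ne'
  have h0 : 0 ≤ ∫ x, ‖f x‖ ^ p.toReal ∂μ := integral_nonneg fun x => by positivity
  rw [Lp.norm_def, (Lp.memLp f).eLpNorm_eq_integral_rpow_norm hp0 hp,
    ENNReal.toReal_ofReal (by positivity),
    Real.rpow_inv_rpow h0 (ENNReal.toReal_pos hp0 hp).ne']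

theorem norm_fn_ofTestFunction_rpow (hp : p ≠ ∞) (ψ : 𝓓(Ω, ℝ)) :
    ‖fn (ofTestFunction ψ : SobolevSpace Ω ℝ p)‖ ^ p.toReal = ∫ x, |ψ x| ^ p.toReal := by
  have hp0 : p ≠ 0 := (one_pos.trans_le (Fact.out : 1 ≤ p)).ne'
  rw [norm_rpow_eq_integral hp, ← setIntegral_eq_integral_of_forall_compl_eq_zero
    (s := (Ω : Set (EuclideanSpace ℝ (Fin n)))) (f := fun x => |ψ x| ^ p.toReal) fun x hx => by
      rw [ψ.eq_zero_of_notMem hx, abs_zero, Real.zero_rpow (ENNReal.toReal_pos hp0 hp).ne']]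
  refine integral_congr_ae ?_
  filter_upwards [fn_ofTestFunction (p := p) ψ] with x hx
  rw [hx, Real.norm_eq_abs]

theorem norm_grad_ofTestFunction_rpow (hp : p ≠ ∞) (ψ : 𝓓(Ω, ℝ)) :
    ‖grad (ofTestFunction ψ : SobolevSpace Ω ℝ p)‖ ^ p.toReal =
      ∫ x, ‖gradient ψ x‖ ^ p.toReal := by
  have hp0 : p ≠ 0 := (one_pos.trans_le (Fact.out : 1 ≤ p)).ne'
  rw [norm_rpow_eq_integral hp, ← setIntegral_eq_integral_of_forall_compl_eq_zero
    (s := (Ω : Set (EuclideanSpace ℝ (Fin n)))) (f := fun x => ‖gradient ψ x‖ ^ p.toReal)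
    fun x hx => by
      rw [ψ.gradient_eq_zero_of_notMem hx, norm_zero,
        Real.zero_rpow (ENNReal.toReal_pos hp0 hp).ne']]
  refine integral_congr_ae ?_
  filter_upwards [grad_ofTestFunction (p := p) ψ] with x hx
  exact congrArg (fun y : EuclideanSpace ℝ (Fin n) => ‖y‖ ^ p.toReal) hx

theorem integral_abs_rpow_le_integral_gradient_rpow {P R : ℝ} (hP : 1 < P) (hR : 0 ≤ R)
    (i : Fin n) (hΩ : ∀ x ∈ Ω, ‖x‖ ≤ R) (ψ : 𝓓(Ω, ℝ)) :
    ∫ x, |ψ x| ^ P ≤ (P * R) ^ P * ∫ x, ‖gradient ψ x‖ ^ P := by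
  have hP0 : 0 < P := one_pos.trans hP
  refine (integral_abs_rpow_le_integral_abs_fderiv_rpow hP hR i ψ.contDiff_one
    ψ.hasCompactSupport fun x hx => ?_).trans ?_
  · refine (PiLp.norm_apply_le x i).trans (hΩ x ?_)
    by_contra h
    exact hx (ψ.eq_zero_of_notMem h)
  · refine mul_le_mul_of_nonneg_left (integral_mono_of_nonneg
      (.of_forall fun x => by positivity) ?_ (.of_forall fun x => ?_)) (by positivity)
    · exact (ψ.contDiff_one.continuous_gradient.norm.rpow_const
        fun _ => Or.inr hP0.le).integrable_of_hasCompactSupport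
        (ψ.hasCompactSupport.gradient.comp_left (g := fun t : EuclideanSpace ℝ (Fin n) =>
          ‖t‖ ^ P) (by simp [hP0.ne']))
    · refine Real.rpow_le_rpow (abs_nonneg _) ?_ hP0.le
      rw [← gradient_apply_eq_fderiv_single]
      exact PiLp.norm_apply_le (gradient ψ x) i

set_option maxHeartbeats 1000000 in
/-- Poincaré's inequality on `W^{1,p}_0(Ω)` for bounded `Ω`. -/
theorem exists_norm_fn_le_norm_grad (hn : 1 ≤ n)
    (hΩ : Bornology.IsBounded (Ω : Set (EuclideanSpace ℝ (Fin n)))) (hp : 1 < p) (hp' : p ≠ ∞) :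
    ∃ C, 0 ≤ C ∧ ∀ u ∈ zeroBoundary Ω p, ‖fn u‖ ≤ C * ‖grad u‖ := by
  obtain ⟨R, hR, hΩR⟩ := hΩ.exists_pos_norm_le
  have hP : 1 < p.toReal := by
    simpa using (ENNReal.toReal_lt_toReal ENNReal.one_ne_top hp').2 hp
  have hP0 : 0 < p.toReal := one_pos.trans hP
  refine ⟨p.toReal * R, by positivity, fun u hu => ?_⟩
  refine zeroBoundary_induction (P := fun u => ‖fn u‖ ≤ p.toReal * R * ‖grad u‖)
    (isClosed_le fn.continuous.norm (continuous_const.mul grad.continuous.norm)) (fun ψ => ?_) hu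
  refine (Real.rpow_le_rpow_iff (norm_nonneg _) (by positivity) hP0).1 ?_
  rw [Real.mul_rpow (by positivity) (norm_nonneg _), norm_fn_ofTestFunction_rpow hp',
    norm_grad_ofTestFunction_rpow hp']
  -- A single coordinate direction suffices; `n ≥ 1` provides one.
  exact integral_abs_rpow_le_integral_gradient_rpow hP hR.le ⟨0, hn⟩ hΩR ψ

end SobolevSpace

/-! ### Abstract minimisation by uniform convexity -/

/-- A normed space in which `‖·‖ ^ P` is uniformly convex on bounded sets. -/
def NormRpowUniformlyConvex (N : Type*) [NormedAddCommGroup N] [NormedSpace ℝ N] (P : ℝ) : Prop :=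
  ∀ ε : ℝ, 0 < ε → ∃ C, 0 ≤ C ∧ ∀ a b : N,
    ‖a - b‖ ^ P ≤ ε * (‖a‖ ^ P + ‖b‖ ^ P) + C * rpowMidpointGap P a b

section Minimization

variable {X N : Type*} [NormedAddCommGroup X] [NormedSpace ℝ X]
  [NormedAddCommGroup N] [NormedSpace ℝ N]

/-- The energy `‖A x‖ ^ P / P - L x`. -/
noncomputable def rpowEnergy (A : X →L[ℝ] N) (L : X →L[ℝ] ℝ) (P : ℝ) (x : X) : ℝ :=
  ‖A x‖ ^ P / P - L x

variable {A : X →L[ℝ] N} {L : X →L[ℝ] ℝ} {P : ℝ}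

theorem continuous_rpowEnergy (hP : 0 ≤ P) : Continuous (rpowEnergy A L P) :=
  ((A.continuous.norm.rpow_const fun _ => Or.inr hP).div_const P).sub L.continuous

/-- The linear term cancels, so near-minimality of two points and of their midpoint controls the
gap. -/
theorem rpowEnergy_midpoint (x y : X) :
    rpowMidpointGap P (A x) (A y) / P = (rpowEnergy A L P x + rpowEnergy A L P y) / 2 -
      rpowEnergy A L P ((2⁻¹ : ℝ) • (x + y)) := by
  simp only [rpowEnergy, rpowMidpointGap, map_smul, map_add, smul_eq_mul]
  ring

/-- Coercivity: on the coset `‖x‖`, hence `L x`, grows at most linearly in `‖A x‖`, and the power `P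
> 1` dominates. -/
theorem exists_norm_le_rpowEnergy_add {V : Submodule ℝ X} {C : ℝ} (hP : 1 < P) (hC : 0 ≤ C)
    (hV : ∀ v ∈ V, ‖v‖ ≤ C * ‖A v‖) (x₀ : X) :
    ∃ D, ∀ x, x - x₀ ∈ V → ‖A x‖ ≤ rpowEnergy A L P x + D := by
  have hq : P.HolderConjugate P.conjExponent := .conjExponent hP
  set q := P.conjExponent
  set a := ‖L‖ * C with ha
  have ha0 : 0 ≤ a := by positivity
  refine ⟨‖L‖ * (‖x₀‖ + C * ‖A x₀‖) + (a + 1) ^ q / q, fun x hx => ?_⟩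
  -- The weight is `a + 1`: the part `a` pays for `L x`, and the extra `1` leaves `‖A x‖` on the
  -- left.
  have y := Real.young_inequality_of_nonneg (norm_nonneg (A x)) (by positivity : 0 ≤ a + 1) hq
  have h1 : L x ≤ ‖L‖ * (‖x₀‖ + C * (‖A x‖ + ‖A x₀‖)) := by
    refine (le_abs_self _).trans ((L.le_opNorm x).trans ?_)
    gcongr
    calc ‖x‖ = ‖x₀ + (x - x₀)‖ := by rw [add_sub_cancel]
      _ ≤ ‖x₀‖ + ‖x - x₀‖ := norm_add_le _ _
      _ ≤ ‖x₀‖ + C * ‖A (x - x₀)‖ := by gcongr; exact hV _ hx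
      _ ≤ _ := by rw [map_sub]; gcongr; exact norm_sub_le _ _
  have h2 : ‖L‖ * (‖x₀‖ + C * (‖A x‖ + ‖A x₀‖)) =
      a * ‖A x‖ + ‖L‖ * (‖x₀‖ + C * ‖A x₀‖) := by rw [ha]; ring
  rw [rpowEnergy]
  linarith

/-- The energy `‖A x‖ ^ P / P - L x` attains its minimum on every coset of a closed subspace on
which `A` is bounded below. -/
theorem exists_rpowEnergy_le [CompleteSpace X] (hN : NormRpowUniformlyConvex N P)
    {V : Submodule ℝ X} (hVc : IsClosed (V : Set X)) {C : ℝ} (hP : 1 < P) (hC : 0 ≤ C)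
    (hV : ∀ v ∈ V, ‖v‖ ≤ C * ‖A v‖) (x₀ : X) :
    ∃ x, x - x₀ ∈ V ∧ ∀ y, y - x₀ ∈ V → rpowEnergy A L P x ≤ rpowEnergy A L P y := by
  have hP0 : 0 < P := one_pos.trans hP
  set J := rpowEnergy A L P with hJ
  obtain ⟨D, hD⟩ := exists_norm_le_rpowEnergy_add (A := A) (L := L) hP hC hV x₀
  set S : Set X := {x | x - x₀ ∈ V} with hS
  have hSc : IsClosed S := hVc.preimage (continuous_id.sub continuous_const)
  have hbdd : BddBelow (J '' S) := by
    refine ⟨-D, ?_⟩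
    rintro _ ⟨x, hx, rfl⟩
    linarith [hD x hx, norm_nonneg (A x)]
  have hne : (J '' S).Nonempty := ⟨J x₀, x₀, by simp [hS], rfl⟩
  set m := sInf (J '' S) with hm
  have hmle : ∀ x ∈ S, m ≤ J x := fun x hx => csInf_le hbdd ⟨x, hx, rfl⟩
  obtain ⟨u, hanti, hlim, hu⟩ := exists_seq_tendsto_sInf hne hbdd
  choose f hfS hfu using hu
  have hlim' : Filter.Tendsto (fun k => J (f k)) Filter.atTop (nhds m) := by simpa [hfu] using hlim
  -- The energies decrease along the sequence, so coercivity at index `0` bounds every `‖A (f k)‖`.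
  set M := J (f 0) + D with hM
  have hAM : ∀ k, ‖A (f k)‖ ≤ M := fun k => by
    have := hanti (Nat.zero_le k)
    rw [← hfu k, ← hfu 0] at this
    linarith [hD _ (hfS k)]
  have hM0 : 0 ≤ M := (norm_nonneg _).trans (hAM 0)
  -- Midpoints stay in the coset, so their energy is at least the infimum `m`.
  have hgap : ∀ i j, rpowMidpointGap P (A (f i)) (A (f j)) ≤
      P * ((J (f i) + J (f j)) / 2 - m) := fun i j => by
    rw [← div_le_iff₀' hP0, rpowEnergy_midpoint (L := L)]
    have hmid : (2⁻¹ : ℝ) • (f i + f j) ∈ S := by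
      have e : (2⁻¹ : ℝ) • (f i + f j) - x₀ = (2⁻¹ : ℝ) • ((f i - x₀) + (f j - x₀)) := by
        module
      rw [hS, Set.mem_ofPred_eq, e]
      exact V.smul_mem _ (V.add_mem (hfS i) (hfS j))
    linarith [hmle _ hmid]
  have hcauchy : CauchySeq f := by
    refine Metric.cauchySeq_iff.2 fun η hη => ?_
    set t := (η / (C + 1)) ^ P with ht
    have htpos : 0 < t := by positivity
    -- Chosen so that the `ε` term is at most `t / 2`; `n₀` below makes the gap term less than `t /
    -- 2`. The added ones keep the denominators positive.
    obtain ⟨K, hK, hUC⟩ := hN (t / (4 * (M ^ P + 1))) (by positivity)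
    obtain ⟨n₀, hn₀⟩ := Filter.eventually_atTop.1
      (hlim'.eventually (gt_mem_nhds (lt_add_of_pos_right m
        (by positivity : 0 < t / (2 * (K * P + 1))))))
    refine ⟨n₀, fun i hi j hj => ?_⟩
    have h1 := hUC (A (f i)) (A (f j))
    have h2 : ∀ k, ‖A (f k)‖ ^ P ≤ M ^ P := fun k =>
      Real.rpow_le_rpow (norm_nonneg _) (hAM k) hP0.le
    have h3 : t / (4 * (M ^ P + 1)) * (‖A (f i)‖ ^ P + ‖A (f j)‖ ^ P) ≤ t / 2 := by
      calc _ ≤ t / (4 * (M ^ P + 1)) * (2 * (M ^ P + 1)) := by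
            gcongr; linarith [h2 i, h2 j]
        _ = t / 2 := by
          have : M ^ P + 1 ≠ 0 := by positivity
          field_simp; norm_num
    have h4 : K * rpowMidpointGap P (A (f i)) (A (f j)) < t / 2 := by
      calc _ ≤ K * (P * ((J (f i) + J (f j)) / 2 - m)) := by gcongr; exact hgap i j
        _ ≤ K * (P * (t / (2 * (K * P + 1)))) := by
          gcongr; linarith [hn₀ i hi, hn₀ j hj]
        _ = t / 2 * (K * P / (K * P + 1)) := by field_simp
        _ < t / 2 * 1 := by
          gcongr
          rw [div_lt_one (by positivity)]
          linarith
        _ = t / 2 := mul_one _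
    have h5 : ‖A (f i) - A (f j)‖ < η / (C + 1) := by
      refine (Real.rpow_lt_rpow_iff (norm_nonneg _) (by positivity) hP0).1 ?_
      linarith
    have h6 : f i - f j ∈ V := by
      rw [← sub_sub_sub_cancel_right (f i) (f j) x₀]
      exact V.sub_mem (hfS i) (hfS j)
    rw [dist_eq_norm]
    calc ‖f i - f j‖ ≤ C * ‖A (f i - f j)‖ := hV _ h6
      _ ≤ (C + 1) * ‖A (f i) - A (f j)‖ := by rw [map_sub]; gcongr; linarith
      _ < (C + 1) * (η / (C + 1)) := by gcongr
      _ = η := by field_simp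
  obtain ⟨x, hx⟩ := cauchySeq_tendsto_of_complete hcauchy
  have hxJ : J x = m := tendsto_nhds_unique
    (((continuous_rpowEnergy hP0.le).tendsto x).comp hx) hlim'
  exact ⟨x, hSc.mem_of_tendsto hx (.of_forall hfS), fun y hy => hxJ.trans_le (hmle y hy)⟩

end Minimization

/-! ### Uniform convexity and differentiability of the `L^p` norm -/

section Lp

variable {α E : Type*} [MeasurableSpace α] {μ : Measure α} {p : ℝ≥0∞} [Fact (1 ≤ p)]

/-- The constant in the finite-dimensional inequality does not depend on the vectors, and every term
in it is built from `p`-th powers of norms, so it integrates to the same inequality for `L^p` norms.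
-/
theorem normRpowUniformlyConvex_Lp [NormedAddCommGroup E] [NormedSpace ℝ E]
    [FiniteDimensional ℝ E] [StrictConvexSpace ℝ E] (hp : 1 < p) (hp' : p ≠ ∞) :
    NormRpowUniformlyConvex (Lp E p μ) p.toReal := by
  intro ε hε
  have hP : 1 < p.toReal := by
    simpa using (ENNReal.toReal_lt_toReal ENNReal.one_ne_top hp').2 hp
  obtain ⟨C, hC, h⟩ := exists_norm_sub_rpow_le_add_gap (E := E) hP hε
  refine ⟨C, hC, fun a b => ?_⟩
  have hi : ∀ f : Lp E p μ, Integrable (fun x => ‖f x‖ ^ p.toReal) μ := fun f =>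
    (Lp.memLp f).integrable_norm_rpow (one_pos.trans hp).ne' hp'
  have e1 : ∫ x, ‖(a - b) x‖ ^ p.toReal ∂μ = ∫ x, ‖a x - b x‖ ^ p.toReal ∂μ := by
    refine integral_congr_ae ?_
    filter_upwards [Lp.coeFn_sub a b] with x hx
    rw [hx, Pi.sub_apply]
  have ae2 : (fun x => ‖((2⁻¹ : ℝ) • (a + b) : Lp E p μ) x‖ ^ p.toReal) =ᵐ[μ]
      fun x => ‖(2⁻¹ : ℝ) • (a x + b x)‖ ^ p.toReal := by
    filter_upwards [Lp.coeFn_smul (2⁻¹ : ℝ) (a + b), Lp.coeFn_add a b] with x hx hx'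
    rw [hx, Pi.smul_apply, hx', Pi.add_apply]
  have ia : Integrable (fun x => (‖a x‖ ^ p.toReal + ‖b x‖ ^ p.toReal)) μ := (hi a).add (hi b)
  have im : Integrable (fun x => ‖(2⁻¹ : ℝ) • (a x + b x)‖ ^ p.toReal) μ := (hi _).congr ae2
  have ig : Integrable (fun x => rpowMidpointGap p.toReal (a x) (b x)) μ :=
    (ia.div_const 2).sub im
  have eg : rpowMidpointGap p.toReal a b = ∫ x, rpowMidpointGap p.toReal (a x) (b x) ∂μ := by
    simp only [rpowMidpointGap]
    rw [integral_sub (ia.div_const 2) im, integral_div, integral_add (hi a) (hi b),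
      ← integral_congr_ae ae2]
    simp only [SobolevSpace.norm_rpow_eq_integral hp']
  rw [eg]
  simp only [SobolevSpace.norm_rpow_eq_integral hp']
  rw [e1, ← integral_add (hi a) (hi b), ← integral_const_mul, ← integral_const_mul,
    ← integral_add (ia.const_mul ε) (ig.const_mul C)]
  exact integral_mono_of_nonneg (.of_forall fun x => by positivity)
    ((ia.const_mul ε).add (ig.const_mul C)) (.of_forall fun x => h (a x) (b x))

/-- The Gateaux derivative of `‖·‖ ^ p` on `L^p`. -/
theorem hasDerivAt_norm_add_smul_rpow_Lp [NormedAddCommGroup E] [InnerProductSpace ℝ E]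
    (hp : 1 < p) (hp' : p ≠ ∞) (a b : Lp E p μ) :
    Integrable (fun x => ‖a x‖ ^ (p.toReal - 2) * inner ℝ (a x) (b x)) μ ∧
    HasDerivAt (fun t : ℝ => ‖a + t • b‖ ^ p.toReal / p.toReal)
      (∫ x, ‖a x‖ ^ (p.toReal - 2) * inner ℝ (a x) (b x) ∂μ) 0 := by
  have hP : 1 < p.toReal := by
    simpa using (ENNReal.toReal_lt_toReal ENNReal.one_ne_top hp').2 hp
  set P := p.toReal with hPdef
  have hP0 : 0 < P := one_pos.trans hP
  have ha := Lp.aestronglyMeasurable a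
  have hb := Lp.aestronglyMeasurable b
  have hm : ∀ t : ℝ, AEStronglyMeasurable (fun x => a x + t • b x) μ := fun t =>
    ha.add (hb.const_smul t)
  have hint : Integrable (fun x => (‖a x‖ + ‖b x‖) ^ P) μ := by
    have := ((Lp.memLp a).norm.add (Lp.memLp b).norm).integrable_norm_rpow
      (one_pos.trans hp).ne' hp'
    refine this.congr (.of_forall fun x => ?_)
    simp only [Pi.add_apply]
    rw [Real.norm_of_nonneg (by positivity)]
  -- Differentiation under the integral for `|t| < 1`, where Cauchy–Schwarz bounds the derivative by
  -- `(‖a‖ + ‖b‖) ^ P`.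
  have hder := hasDerivAt_integral_of_dominated_loc_of_deriv_le (μ := μ) (𝕜 := ℝ) (x₀ := 0)
    (F := fun t x => ‖a x + t • b x‖ ^ P / P)
    (F' := fun t x => ‖a x + t • b x‖ ^ (P - 2) * inner ℝ (a x + t • b x) (b x))
    (s := Metric.ball 0 1) (bound := fun x => (‖a x‖ + ‖b x‖) ^ P)
    (Metric.ball_mem_nhds _ one_pos)
    (.of_forall fun t => (((hm t).norm.aemeasurable.pow_const P).div_const P).aestronglyMeasurable)
    ?_ ?_ ?_ hint ?_
  · simp only [zero_smul, add_zero] at hder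
    refine ⟨hder.1, hder.2.congr_of_eventuallyEq (.of_forall fun t => ?_)⟩
    simp only
    rw [SobolevSpace.norm_rpow_eq_integral hp', ← integral_div]
    refine integral_congr_ae ?_
    filter_upwards [Lp.coeFn_add a (t • b), Lp.coeFn_smul t b] with x hx hx'
    rw [hx, Pi.add_apply, hx', Pi.smul_apply]
  · simpa using ((Lp.memLp a).integrable_norm_rpow (one_pos.trans hp).ne' hp').div_const P
  · exact (((hm 0).norm.aemeasurable.pow_const (P - 2)).aestronglyMeasurable).mul ((hm 0).inner hb)
  · refine .of_forall fun x t ht => ?_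
    have ht' : |t| ≤ 1 := by
      rw [mem_ball_zero_iff, Real.norm_eq_abs] at ht; exact ht.le
    rw [norm_mul, Real.norm_of_nonneg (by positivity)]
    -- The exponent `P - 2` may be negative; where the vector vanishes, the inner product makes the
    -- term zero.
    rcases eq_or_ne (a x + t • b x) 0 with h0 | h0
    · rw [h0, inner_zero_left, norm_zero, norm_zero, mul_zero]; positivity
    · have hpos : 0 < ‖a x + t • b x‖ := norm_pos_iff.2 h0
      have hle : ‖a x + t • b x‖ ≤ ‖a x‖ + ‖b x‖ := by
        refine (norm_add_le _ _).trans ?_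
        rw [norm_smul, Real.norm_eq_abs]
        have := mul_le_mul_of_nonneg_right ht' (norm_nonneg (b x))
        linarith
      calc _ ≤ ‖a x + t • b x‖ ^ (P - 2) * (‖a x + t • b x‖ * ‖b x‖) := by
            gcongr; exact norm_inner_le_norm _ _
        _ = ‖a x + t • b x‖ ^ (P - 1) * ‖b x‖ := by
          rw [← mul_assoc, ← Real.rpow_add_one hpos.ne']; ring_nf
        _ ≤ (‖a x‖ + ‖b x‖) ^ (P - 1) * (‖a x‖ + ‖b x‖) := by
          gcongr
          linarith [norm_nonneg (a x)]
        _ = (‖a x‖ + ‖b x‖) ^ P := by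
          rw [← Real.rpow_add_one (hpos.trans_le hle).ne']; ring_nf
  · refine .of_forall fun x t _ => ?_
    have h1 : HasDerivAt (fun t : ℝ => a x + t • b x) (b x) t := by
      simpa using ((hasDerivAt_id t).smul_const (b x)).const_add (a x)
    have h2 := ((hasFDerivAt_norm_rpow (a x + t • b x) hP).comp_hasDerivAt t h1).div_const P
    refine h2.congr_deriv ?_
    rw [smul_apply, innerSL_apply_apply, smul_eq_mul, mul_assoc,
      mul_div_cancel_left₀ _ hP0.ne']

/-- The Euler–Lagrange equation along one line: the derivative at the minimum `t = 0` vanishes. -/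
theorem integral_eq_of_forall_norm_rpow_le [NormedAddCommGroup E] [InnerProductSpace ℝ E]
    (hp : 1 < p) (hp' : p ≠ ∞) (a b : Lp E p μ) {c d : ℝ}
    (hmin : ∀ t : ℝ, ‖a‖ ^ p.toReal / p.toReal - c ≤
      ‖a + t • b‖ ^ p.toReal / p.toReal - (c + t * d)) :
    ∫ x, ‖a x‖ ^ (p.toReal - 2) * inner ℝ (a x) (b x) ∂μ = d := by
  have hd : HasDerivAt (fun t : ℝ => c + t * d) d 0 := by
    simpa using ((hasDerivAt_id (0 : ℝ)).mul_const d).const_add c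
  refine sub_eq_zero.1 (IsLocalMin.hasDerivAt_eq_zero (.of_forall fun t => ?_)
    ((hasDerivAt_norm_add_smul_rpow_Lp hp hp' a b).2.sub hd))
  simpa using hmin t

end Lp

/-! ### The `p`-Laplace energy and its minimiser -/

theorem SobolevSpace.norm_le_norm_fn_add_norm_grad {n : ℕ}
    {Ω : Opens (EuclideanSpace ℝ (Fin n))} {p : ℝ≥0∞} [Fact (1 ≤ p)] (u : SobolevSpace Ω ℝ p) :
    ‖u‖ ≤ ‖fn u‖ + ‖grad u‖ := by
  set w := (u : WithLp p (Lp ℝ p (volume.restrict (Ω : Set (EuclideanSpace ℝ (Fin n)))) ×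
    Lp (Grad n ℝ) p (volume.restrict (Ω : Set (EuclideanSpace ℝ (Fin n)))))) with hw
  have e : w = WithLp.toLp p (w.fst, 0) + WithLp.toLp p (0, w.snd) :=
    WithLp.ofLp_injective p (by ext1 <;> simp)
  have h : ‖w‖ ≤ ‖w.fst‖ + ‖w.snd‖ := by
    calc ‖w‖ = ‖WithLp.toLp p (w.fst, 0) + WithLp.toLp p (0, w.snd)‖ := congrArg _ e
      _ ≤ _ := norm_add_le _ _
      _ = ‖w.fst‖ + ‖w.snd‖ := by
        rw [WithLp.norm_toLp_fst, WithLp.norm_toLp_snd]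
  exact h

namespace SobolevSpace

variable {n : ℕ} {Ω : Opens (EuclideanSpace ℝ (Fin n))} {p p' : ℝ≥0∞} [Fact (1 ≤ p)]
  [Fact (1 ≤ p')] [ENNReal.HolderConjugate p' p]

/-- The functional `f ↦ ∫_Ω g f dx` on `W^{1,p}(Ω)`. -/
noncomputable def sourceFunctional
    (g : Lp ℝ p' (volume.restrict (Ω : Set (EuclideanSpace ℝ (Fin n))))) :
    SobolevSpace Ω ℝ p →L[ℝ] ℝ :=
  ((ContinuousLinearMap.mul ℝ ℝ).lpPairing
    (volume.restrict (Ω : Set (EuclideanSpace ℝ (Fin n)))) p' p g).comp fn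

theorem sourceFunctional_ofTestFunction
    (g : Lp ℝ p' (volume.restrict (Ω : Set (EuclideanSpace ℝ (Fin n))))) (ψ : 𝓓(Ω, ℝ)) :
    sourceFunctional g (ofTestFunction ψ : SobolevSpace Ω ℝ p) =
      ∫ x in (Ω : Set (EuclideanSpace ℝ (Fin n))), g x * ψ x := by
  refine (ContinuousLinearMap.lpPairing_eq_integral _ _ _).trans (integral_congr_ae ?_)
  filter_upwards [fn_ofTestFunction (p := p) ψ] with x hx
  exact congrArg (g x * ·) hx

/-- The energy `(1/p) ∫_Ω |Df|^p dx - ∫_Ω g f dx`. -/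
noncomputable def pLaplaceEnergy
    (g : Lp ℝ p' (volume.restrict (Ω : Set (EuclideanSpace ℝ (Fin n))))) :
    SobolevSpace Ω ℝ p → ℝ :=
  rpowEnergy (X := SobolevSpace Ω ℝ p)
    (N := Lp (Grad n ℝ) p (volume.restrict (Ω : Set (EuclideanSpace ℝ (Fin n)))))
    grad (sourceFunctional g) p.toReal

theorem pLaplaceEnergy_add_smul
    (g : Lp ℝ p' (volume.restrict (Ω : Set (EuclideanSpace ℝ (Fin n)))))
    (f v : SobolevSpace Ω ℝ p) (t : ℝ) :
    pLaplaceEnergy g (f + t • v) = ‖grad f + t • grad v‖ ^ p.toReal / p.toReal -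
      (sourceFunctional g f + t * sourceFunctional g v) := by
  have h1 : grad (f + t • v) = grad f + t • grad v :=
    (map_add grad f (t • v)).trans (congrArg _ (map_smul grad t v))
  have h2 : sourceFunctional g (f + t • v) = sourceFunctional g f + t * sourceFunctional g v :=
    (map_add (sourceFunctional g) f (t • v)).trans (congrArg _ (map_smul (sourceFunctional g) t v))
  exact congrArg₂ (fun (G : Lp (Grad n ℝ) p (volume.restrict (Ω : Set (EuclideanSpace ℝ (Fin n)))))
    (c : ℝ) => ‖G‖ ^ p.toReal / p.toReal - c) h1 h2

set_option maxHeartbeats 1000000 in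
/-- A minimiser of the energy in the directions of test functions solves the weak `p`-Laplace
equation. -/
theorem integral_eq_zero_of_forall_pLaplaceEnergy_le (hp : 1 < p) (hp' : p ≠ ∞)
    (g : Lp ℝ p' (volume.restrict (Ω : Set (EuclideanSpace ℝ (Fin n)))))
    (f : SobolevSpace Ω ℝ p) (ψ : 𝓓(Ω, ℝ))
    (hmin : ∀ t : ℝ, pLaplaceEnergy g f ≤ pLaplaceEnergy g (f + t • ofTestFunction ψ)) :
    ∫ x in (Ω : Set (EuclideanSpace ℝ (Fin n))),
      (‖grad f x‖ ^ (p.toReal - 2) * inner ℝ (grad f x) (gradient ψ x) - g x * ψ x) = 0 := by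
  set v : SobolevSpace Ω ℝ p := ofTestFunction ψ with hv
  have hint := (hasDerivAt_norm_add_smul_rpow_Lp
    (E := EuclideanSpace ℝ (Fin n)) hp hp' (grad f) (grad v)).1
  have key := integral_eq_of_forall_norm_rpow_le (E := EuclideanSpace ℝ (Fin n)) hp hp'
    (grad f) (grad v) fun t => (hmin t).trans_eq (pLaplaceEnergy_add_smul g f v t)
  have hae : (fun x => ‖grad f x‖ ^ (p.toReal - 2) *
        inner ℝ (grad f x : EuclideanSpace ℝ (Fin n)) (grad v x))
      =ᵐ[volume.restrict (Ω : Set (EuclideanSpace ℝ (Fin n)))]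
      fun x => ‖grad f x‖ ^ (p.toReal - 2) * inner ℝ (grad f x) (gradient ψ x) := by
    filter_upwards [grad_ofTestFunction (p := p) ψ] with x hx
    exact congrArg (fun y : EuclideanSpace ℝ (Fin n) =>
      ‖grad f x‖ ^ (p.toReal - 2) * inner ℝ (grad f x : EuclideanSpace ℝ (Fin n)) y) hx
  have hg : Integrable (fun x => g x * ψ x)
      (volume.restrict (Ω : Set (EuclideanSpace ℝ (Fin n)))) :=
    (Lp.memLp g).integrable_mul (ψ.memLp p)
  exact (integral_sub (hint.congr hae) hg).trans (sub_eq_zero.2 ((integral_congr_ae hae).symm.trans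
    (key.trans (sourceFunctional_ofTestFunction g ψ))))

set_option maxHeartbeats 1000000 in
theorem exists_pLaplaceEnergy_le (hn : 1 ≤ n)
    (hΩ : Bornology.IsBounded (Ω : Set (EuclideanSpace ℝ (Fin n)))) (hp : 1 < p) (hp' : p ≠ ∞)
    (g : Lp ℝ p' (volume.restrict (Ω : Set (EuclideanSpace ℝ (Fin n)))))
    (f_b : SobolevSpace Ω ℝ p) :
    ∃ f, f - f_b ∈ zeroBoundary Ω p ∧
      ∀ h, h - f_b ∈ zeroBoundary Ω p → pLaplaceEnergy g f ≤ pLaplaceEnergy g h := by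
  have : CompleteSpace (SobolevSpace Ω ℝ p) := completeSpace p'
  have hP : 1 < p.toReal := by
    simpa using (ENNReal.toReal_lt_toReal ENNReal.one_ne_top hp').2 hp
  obtain ⟨C, hC, hpoinc⟩ := exists_norm_fn_le_norm_grad (p := p) hn hΩ hp hp'
  -- Poincaré's inequality bounds the full Sobolev norm by the gradient, the lower bound on `A` that
  -- the abstract minimisation needs.
  have hV : ∀ v ∈ zeroBoundary Ω p, ‖v‖ ≤ (C + 1) * ‖grad v‖ := fun v hv => by
    have h1 := norm_le_norm_fn_add_norm_grad v
    have h2 := hpoinc v hv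
    linarith
  exact exists_rpowEnergy_le (X := SobolevSpace Ω ℝ p)
    (N := Lp (Grad n ℝ) p (volume.restrict (Ω : Set (EuclideanSpace ℝ (Fin n)))))
    (normRpowUniformlyConvex_Lp (E := EuclideanSpace ℝ (Fin n)) hp hp')
    (Submodule.isClosed_topologicalClosure _) hP (by positivity) hV f_b

end SobolevSpace

open SobolevSpace in
theorem mainTheorem10 {n : ℕ} (hn : 1 ≤ n) (Ω : Opens (EuclideanSpace ℝ (Fin n)))
    (hΩ : Bornology.IsBounded (Ω : Set (EuclideanSpace ℝ (Fin n))))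
    (p p' : ℝ≥0∞) [Fact (1 ≤ p)] (hp : 1 < p) (hp_top : p < ∞) (hpp' : p⁻¹ + p'⁻¹ = 1)
    (g : Lp ℝ p' (volume.restrict (Ω : Set (EuclideanSpace ℝ (Fin n)))))
    (f_b : SobolevSpace Ω ℝ p) :
    ∃ f : SobolevSpace Ω ℝ p, IsWeakSolutionPLaplace hΩ g f_b f := by
  have hconj : ENNReal.HolderConjugate p' p :=
    ENNReal.holderConjugate_iff.2 ((add_comm _ _).trans hpp')
  have : Fact (1 ≤ p') := ⟨ENNReal.HolderConjugate.one_le p' p⟩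
  obtain ⟨f, hf, hmin⟩ := exists_pLaplaceEnergy_le hn hΩ hp hp_top.ne g f_b
  refine ⟨f, fun ψ => integral_eq_zero_of_forall_pLaplaceEnergy_le hp hp_top.ne g f ψ fun t =>
    hmin _ ?_, fun φ => ?_⟩
  -- Variations along test functions stay in the coset of `f_b`.
  · rw [add_sub_right_comm]
    exact Submodule.add_mem _ hf (Submodule.smul_mem _ t (ofTestFunction_mem_zeroBoundary ψ))
  · rw [traceOp_toW11_eq_zero hΩ hf, zero_apply]
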